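/- Let $d\in\{1,2,3\}$, $L>0$, $r>0$. Let $L^2_{\rm per}$ be the (complex) space of $L\mathbb Z^d$-periodic locally square integrable functions on $\mathbb R^d$, normed by $\|\cdot\|_{L^2(\Omega)}$ with $\Omega=[0,L)^d$. Write $(-\Delta+1)^s$ for the Fourier multiplier with symbol $(|{\bf k}|^2+1)^s$, ${\bf k}\in\frac{2\pi}{L}\mathbb Z^d$, and put $$\|A\|_r:=\big\|(-\Delta+1)^{-\frac12+\frac r2}\,A\,(-\Delta+1)^{-\frac12+\frac r2}\big\|_{L^2_{\rm per}\to L^2_{\rm per}} .$$ Let $V$ be a real $L\mathbb Z^d$-periodic potential (a function or a distribution, acting by multiplication) with $\|V\|_r<\infty$. For $M\in\mathbb N$ let $\rho_M:=(2\pi M/L)^2$, let $P_M$ be the orthogonal projection onto the span of the plane waves $e^{i{\bf k}\cdot x}$, ${\bf k}\in\frac{2\pi}{L}\mathbb Z^d$, with $|{\bf k}|^2<\rho_M$, let $P_M^\perp:=1-P_M$, $P_M^N:=P_N-P_M$, and $\kappa_M:=\rho_M-(\rho_M+1)\rho_M^{-r}\|V\|_r$. Let $H:=-\Delta+V$, $H_M^\perp:=P_M^\perp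 HP_M^\perp$ on ${\rm Ran}\,P_M^\perp$ (in the weak sense, with inverse $(H_M^\perp-\lambda)^{-1}$ taking values in $H^1_{\rm per}\cap {\rm Ran}\,P_M^\perp$), $V_M^N:=P_M^NVP_M^N$, and let $G_M^N(\lambda)$ be the inverse of $-\Delta-\lambda$ on ${\rm Ran}\,P_M^N$. For $K\in\mathbb N=\{0,1,2,\dots\}$ and $\sigma=(N,M,K)$ define $$U_M(\lambda):=-P_MVP_M^\perp(H_M^\perp-\lambda)^{-1}P_M^\perp VP_M,$$ $$U_\sigma(\lambda):=-P_MVP_M^N\Big(\sum_{k=0}^K(-1)^k\big[G_M^N(\lambda)V_M^N\big]^kG_M^N(\lambda)\Big)P_M^NVP_M .$$ Let $\lambda\in\mathbb R$. If $\lambda<\min(\kappa_M,\frac12\rho_M)$, $\rho_N\ge\rho_M>1$, $4\rho_M^{-r}\|V\|_r<1$ and $$4\rho_N^{-r}\|V\|_r+\frac{16\rho_M^{-2r}\|V\|_r^2}{1-4\rho_M^{-r}\|V\|_r}<1,$$ then $$\|U_M(\lambda)-U_\sigma(\lambda)\|_r\le\frac{4\rho_N^{-r}\|V\|_r^2}{1-4\rho_N^{-r}\|V\|_r-\frac{16\rho_M^{-2r}\|V\|_r^2}{1-4\rho_M^{-r}\|V\|_r}}\left[1+\frac{4\rho_M^{-r}\|V\|_r}{1-4\rho_M^{-r}\|V\|_r}\right]^2+\frac{4\rho_M^{-r}\|V\|_r^2}{1-4\rho_M^{-r}\|V\|_r}\left[4\rho_M^{-r}\|V\|_r\right]^{K+1}.$$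 -/

import Mathlib

open MeasureTheory Set
open scoped ENNReal ContDiff ComplexConjugate

noncomputable section

namespace PlaneWave

/-- The fundamental cell `Ω = [0, L)^d` of the lattice `Lℤ^d`. -/
def cell (d : ℕ) (L : ℝ) : Set (Fin d → ℝ) := Set.univ.pi fun _ => Set.Ico 0 L

/-- `L²_per`: an `Lℤ^d`-periodic, locally square integrable function is the same thing as
its restriction to the cell `Ω`; the inner product is the one of `L²(Ω)`. -/
abbrev L2per (d : ℕ) (L : ℝ) : Type := Lp ℂ 2 (volume.restrict (cell d L))

/-- Smooth `Lℤ^d`-periodic functions on `ℝ^d`. -/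
def SmoothPer (d : ℕ) (L : ℝ) : Submodule ℂ ((Fin d → ℝ) → ℂ) where
  carrier := {f | ContDiff ℝ ∞ f ∧ ∀ (x : Fin d → ℝ) (n : Fin d → ℤ),
    f (fun i => x i + L * n i) = f x}
  add_mem' := by
    rintro f g ⟨hf, pf⟩ ⟨hg, pg⟩
    exact ⟨hf.add hg, fun x n => by simp only [Pi.add_apply, pf, pg]⟩
  zero_mem' := ⟨contDiff_const, fun _ _ => rfl⟩
  smul_mem' := by
    rintro c f ⟨hf, pf⟩
    exact ⟨hf.const_smul c, fun x n => by simp only [Pi.smul_apply, pf]⟩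

/-- Pointwise product of smooth periodic functions. -/
def SmoothPer.mul {d : ℕ} {L : ℝ} (f g : SmoothPer d L) : SmoothPer d L :=
  ⟨fun x => f.1 x * g.1 x, f.2.1.mul g.2.1, fun x n => by
    show f.1 _ * g.1 _ = _
    rw [f.2.2, g.2.2]⟩

/-- Pointwise complex conjugate of a smooth periodic function. -/
def SmoothPer.conj {d : ℕ} {L : ℝ} (f : SmoothPer d L) : SmoothPer d L :=
  ⟨fun x => starRingEnd ℂ (f.1 x), Complex.conjCLE.contDiff.comp f.2.1, fun x n => by
    show starRingEnd ℂ (f.1 _) = _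
    rw [f.2.2]⟩

/-- `Lℤ^d`-periodic distributions: linear functionals on the smooth periodic functions that
are bounded by finitely many of the sup-norms of the derivatives. -/
structure PerDist (d : ℕ) (L : ℝ) where
  toLin : SmoothPer d L →ₗ[ℂ] ℂ
  bounded : ∃ (m : ℕ) (C : ℝ), ∀ (φ : SmoothPer d L) (B : ℝ),
    (∀ n ≤ m, ∀ x, ‖iteratedFDeriv ℝ n φ.1 x‖ ≤ B) → ‖toLin φ‖ ≤ C * B

/-- A real distribution. -/
def PerDist.IsReal {d : ℕ} {L : ℝ} (V : PerDist d L) : Prop :=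
  ∀ φ : SmoothPer d L, V.toLin (SmoothPer.conj φ) = starRingEnd ℂ (V.toLin φ)

/-- `|k|²` for the point `2πk/L` of the dual lattice: the eigenvalue of `-Δ` on the
`k`-th plane wave. -/
def freqSq {d : ℕ} (L : ℝ) (k : Fin d → ℤ) : ℝ := ∑ i, (2 * Real.pi * k i / L) ^ 2

/-- `ρ_M = (2πM/L)²`. -/
def rho (L : ℝ) (M : ℕ) : ℝ := (2 * Real.pi * M / L) ^ 2

/-- The normalized plane wave `x ↦ L^{-d/2} exp(i (2πk/L)·x)`. -/
def pwFun {d : ℕ} (L : ℝ) (k : Fin d → ℤ) (x : Fin d → ℝ) : ℂ :=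
  ((Real.sqrt (L ^ d))⁻¹ : ℝ) *
    Complex.exp (((∑ i, 2 * Real.pi * k i / L * x i : ℝ) : ℂ) * Complex.I)

theorem contDiff_pwFun {d : ℕ} (L : ℝ) (k : Fin d → ℤ) : ContDiff ℝ ∞ (pwFun L k) := by
  unfold pwFun
  refine contDiff_const.mul (ContDiff.cexp (ContDiff.mul ?_ contDiff_const))
  refine Complex.ofRealCLM.contDiff.comp ?_
  exact ContDiff.sum (s := Finset.univ)
    (f := fun (i : Fin d) (x : Fin d → ℝ) => 2 * Real.pi * k i / L * x i)
    fun i _ => contDiff_const.mul (contDiff_apply ℝ ℝ i)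

theorem pwFun_periodic {d : ℕ} {L : ℝ} (hL : L ≠ 0) (k : Fin d → ℤ) (x : Fin d → ℝ)
    (n : Fin d → ℤ) : pwFun L k (fun i => x i + L * n i) = pwFun L k x := by
  unfold pwFun
  congr 1
  rw [Complex.exp_eq_exp_iff_exists_int]
  refine ⟨∑ i, k i * n i, ?_⟩
  have h : (∑ i, 2 * Real.pi * k i / L * (x i + L * n i) : ℝ)
      = (∑ i, 2 * Real.pi * k i / L * x i) + 2 * Real.pi * ((∑ i, k i * n i : ℤ) : ℝ) := by
    push_cast
    rw [Finset.mul_sum, ← Finset.sum_add_distrib]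
    refine Finset.sum_congr rfl fun i _ => ?_
    field_simp
  rw [h]
  push_cast
  ring

/-- The plane wave as a smooth periodic function. -/
def pwSmooth {d : ℕ} {L : ℝ} (hL : L ≠ 0) (k : Fin d → ℤ) : SmoothPer d L :=
  ⟨pwFun L k, contDiff_pwFun L k, pwFun_periodic hL k⟩

theorem volume_cell_ne_top (d : ℕ) (L : ℝ) : volume (cell d L) ≠ ⊤ := by
  unfold cell
  rw [volume_pi_pi]
  exact ENNReal.prod_ne_top fun i _ => by simp

theorem memLp_pwFun {d : ℕ} (L : ℝ) (k : Fin d → ℤ) :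
    MemLp (pwFun L k) 2 (volume.restrict (cell d L)) := by
  have : IsFiniteMeasure (volume.restrict (cell d L)) :=
    isFiniteMeasure_restrict.2 (volume_cell_ne_top d L)
  refine MemLp.of_bound (contDiff_pwFun L k).continuous.aestronglyMeasurable
    (Real.sqrt (L ^ d))⁻¹ (Filter.Eventually.of_forall fun x => ?_)
  unfold pwFun
  rw [norm_mul, Complex.norm_exp_ofReal_mul_I, mul_one, Complex.norm_real, Real.norm_eq_abs,
    abs_of_nonneg (by positivity)]

/-- The plane wave `e_k` as an element of `L²_per`. -/
def pw {d : ℕ} (L : ℝ) (k : Fin d → ℤ) : L2per d L := (memLp_pwFun L k).toLp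

/-- Fourier coefficients `⟨e_k, u⟩` of `u ∈ L²_per`. -/
def coeff {d : ℕ} {L : ℝ} (u : L2per d L) (k : Fin d → ℤ) : ℂ := inner ℂ (pw L k) u

/-- The trigonometric polynomial `∑ c_k e_k`. -/
def trig {d : ℕ} (L : ℝ) (c : (Fin d → ℤ) →₀ ℂ) : L2per d L := c.sum fun k a => a • pw L k

/-- Matrix elements `⟨e_j, V e_k⟩ = ⟨V, conj(e_j) e_k⟩` of multiplication by `V`. -/
def PerDist.elem {d : ℕ} {L : ℝ} (V : PerDist d L) (hL : L ≠ 0) (j k : Fin d → ℤ) : ℂ :=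
  V.toLin (SmoothPer.mul (SmoothPer.conj (pwSmooth hL j)) (pwSmooth hL k))

/-- The Fourier coefficients of the distribution `V u`. The sum is finite for trigonometric
polynomials, and converges absolutely for `u` in `H^{1-r}` if `‖V‖_r < ∞`. -/
def PerDist.act {d : ℕ} {L : ℝ} (V : PerDist d L) (hL : L ≠ 0) (u : L2per d L)
    (j : Fin d → ℤ) : ℂ := ∑' k, V.elem hL j k * coeff u k

/-- The `L²_per`-norm (in `[0, ∞]`) of the distribution with Fourier coefficients `c`. -/
def l2Norm {d : ℕ} (c : (Fin d → ℤ) → ℂ) : ℝ≥0∞ := (∑' k, ‖c k‖ₑ ^ 2) ^ (1 / 2 : ℝ)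

/-- The symbol of `(-Δ + 1)^s`. -/
def bessel {d : ℕ} (L s : ℝ) (k : Fin d → ℤ) : ℝ := (freqSq L k + 1) ^ s

/-- `(-Δ + 1)^s` on trigonometric polynomials, through their Fourier coefficients. -/
def besselTrig {d : ℕ} (L s : ℝ) (c : (Fin d → ℤ) →₀ ℂ) : (Fin d → ℤ) →₀ ℂ :=
  Finsupp.onFinset c.support (fun k => (bessel L s k : ℂ) * c k) fun k hk => by
    rw [Finsupp.mem_support_iff]
    exact right_ne_zero_of_mul hk

/-- `‖A‖_r`, that is, the operator norm on `L²_per` of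
`(-Δ+1)^{-1/2+r/2} A (-Δ+1)^{-1/2+r/2}`, as an element of `[0, ∞]`. Here `A` is given by the
Fourier coefficients of `A u`; the supremum is over the (dense) trigonometric polynomials. -/
def rNorm {d : ℕ} (L r : ℝ) (A : L2per d L → (Fin d → ℤ) → ℂ) : ℝ≥0∞ :=
  ⨆ c : (Fin d → ℤ) →₀ ℂ,
    l2Norm (fun j => (bessel L (-1 / 2 + r / 2) j : ℂ) *
      A (trig L (besselTrig L (-1 / 2 + r / 2) c)) j) / ‖trig L c‖ₑ

/-- The frequencies `k` with `|k|² < ρ_M`. -/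
def modes (d : ℕ) (L : ℝ) (M : ℕ) : Finset (Fin d → ℤ) :=
  (Fintype.piFinset fun _ => Finset.Icc (-(M : ℤ)) M).filter fun k => freqSq L k < rho L M

theorem mem_modes {d : ℕ} {L : ℝ} (M : ℕ) (k : Fin d → ℤ) :
    k ∈ modes d L M ↔ freqSq L k < rho L M := by
  simp only [modes, Finset.mem_filter, Fintype.mem_piFinset, Finset.mem_Icc, ← abs_le,
    and_iff_right_iff_imp]
  intro h i
  have h1 : (2 * Real.pi * k i / L) ^ 2 ≤ freqSq L k :=
    Finset.single_le_sum (f := fun i => (2 * Real.pi * k i / L) ^ 2)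
      (fun j _ => sq_nonneg _) (Finset.mem_univ i)
  have h2 := sq_lt_sq.1 (h1.trans_lt h)
  rw [mul_div_right_comm, mul_div_right_comm _ (M : ℝ), abs_mul, abs_mul] at h2
  have h3 := lt_of_mul_lt_mul_left h2 (abs_nonneg _)
  have h4 : |k i| < |(M : ℤ)| := by exact_mod_cast h3
  simpa using h4.le

/-- The frequencies `k` with `ρ_M ≤ |k|² < ρ_N`. -/
def band (d : ℕ) (L : ℝ) (M N : ℕ) : Finset (Fin d → ℤ) := modes d L N \ modes d L M

/-- The projection onto the span of the `e_k`, `k ∈ S`, applied to the distribution with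
Fourier coefficients `c`. It is `P_M` for `S = modes d L M` and `P_M^N = P_N - P_M` for
`S = band d L M N`. -/
def proj {d : ℕ} (L : ℝ) (S : Finset (Fin d → ℤ)) (c : (Fin d → ℤ) → ℂ) : L2per d L :=
  ∑ k ∈ S, c k • pw L k

/-- `κ_M = ρ_M - (ρ_M + 1) ρ_M^{-r} ‖V‖_r`, with `v` for `‖V‖_r`. -/
def kappa (L r v : ℝ) (M : ℕ) : ℝ := rho L M - (rho L M + 1) * rho L M ^ (-r) * v

/-- `u ∈ H¹ ∩ Ran P_M^⊥` solves `(H_M^⊥ - lam) u = P_M^⊥ f` weakly, where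
`H_M^⊥ = P_M^⊥ (-Δ + V) P_M^⊥` and `f` is a distribution given by its Fourier coefficients. -/
def IsPerpSolution {d : ℕ} {L : ℝ} (hL : L ≠ 0) (V : PerDist d L) (M : ℕ) (lam : ℝ)
    (f : (Fin d → ℤ) → ℂ) (u : L2per d L) : Prop :=
  Summable (fun k => (freqSq L k + 1) * ‖coeff u k‖ ^ 2) ∧
  (∀ k, freqSq L k < rho L M → coeff u k = 0) ∧
  ∀ j, rho L M ≤ freqSq L j →
    ((freqSq L j - lam : ℝ) : ℂ) * coeff u j + V.act hL u j = f j

open Classical in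
/-- `(H_M^⊥ - lam)^{-1} P_M^⊥ f`: the weak solution `u ∈ H¹ ∩ Ran P_M^⊥`, which exists and is
unique when `H_M^⊥ - lam` is invertible from `H¹` to `H^{-1}` on the range of `P_M^⊥` and
`f ∈ H^{-1}` (zero if there is no solution). -/
def perpResolvent {d : ℕ} {L : ℝ} (hL : L ≠ 0) (V : PerDist d L) (M : ℕ) (lam : ℝ)
    (f : (Fin d → ℤ) → ℂ) : L2per d L :=
  if h : ∃ u, IsPerpSolution hL V M lam f u then h.choose else 0

/-- The exact effective interaction
`U_M(lam) = - P_M V P_M^⊥ (H_M^⊥ - lam)^{-1} P_M^⊥ V P_M`. -/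
def UM {d : ℕ} {L : ℝ} (hL : L ≠ 0) (V : PerDist d L) (M : ℕ) (lam : ℝ) (φ : L2per d L) :
    L2per d L :=
  -proj L (modes d L M) (V.act hL
    (perpResolvent hL V M lam (V.act hL (proj L (modes d L M) (coeff φ)))))

/-- `G_M^N(lam)`, the inverse of `-Δ - lam` on `Ran P_M^N`, extended by zero. -/
def G {d : ℕ} {L : ℝ} (M N : ℕ) (lam : ℝ) (u : L2per d L) : L2per d L :=
  proj L (band d L M N) fun k => ((freqSq L k - lam : ℝ) : ℂ)⁻¹ * coeff u k

/-- `V_M^N = P_M^N V P_M^N`. -/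
def VMN {d : ℕ} {L : ℝ} (hL : L ≠ 0) (V : PerDist d L) (M N : ℕ) (u : L2per d L) :
    L2per d L :=
  proj L (band d L M N) (V.act hL (proj L (band d L M N) (coeff u)))

/-- `R_σ(lam) = ∑_{k=0}^K (-1)^k [G_M^N(lam) V_M^N]^k G_M^N(lam)`, `σ = (N, M, K)`. -/
def Rsigma {d : ℕ} {L : ℝ} (hL : L ≠ 0) (V : PerDist d L) (N M K : ℕ) (lam : ℝ)
    (u : L2per d L) : L2per d L :=
  ∑ k ∈ Finset.range (K + 1),
    (-1 : ℂ) ^ k • (fun w => G M N lam (VMN hL V M N w))^[k] (G M N lam u)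

/-- The truncated effective interaction `U_σ(lam) = - P_M V P_M^N R_σ(lam) P_M^N V P_M`. -/
def Usigma {d : ℕ} {L : ℝ} (hL : L ≠ 0) (V : PerDist d L) (N M K : ℕ) (lam : ℝ)
    (φ : L2per d L) : L2per d L :=
  -proj L (modes d L M) (V.act hL (proj L (band d L M N) (coeff (Rsigma hL V N M K lam
    (proj L (band d L M N) (V.act hL (proj L (modes d L M) (coeff φ))))))))

end PlaneWave

end

/-! Write `b` for the symbol of `(-Δ+1)^(-1/2+r/2)` and substitute `u = b x` on the Fourier side.
Then `V` becomes `A = b V b`, bounded on `ℓ²` with norm at most `v = ‖V‖_r` (`PerDist.exists_conj`),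
and `(-Δ-lam)⁻¹` on the high frequencies becomes a diagonal operator `g`. Since `lam ≤ ρ_M/2` and
`ρ_M > 1`, `‖g‖ ≤ a = 4ρ_M^(-r)` (`green_le_of_le`).

The resolvent equation with right side `P_M^⊥ f` reads `x + g A x = g z`, where `z = b f`. The
truncated series is the partial Neumann sum `s` of the same equation with `g` replaced by its
restriction `g'` to the band, and `‖g - g'‖ ≤ ε = 4ρ_N^(-r)`. If `x'` solves the equation with `g'`,
then `x - x' = (1 + g'A)⁻¹ (g - g') (1 + Ag)⁻¹ z`, which costs `ε/(1-av)²`, while `x' - s` is a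
geometric tail costing `a/(1-av) · (av)^(K+1)` (`norm_sub_neumann_le`). One factor `v` from each
outer `V` gives `rNorm_UM_sub_Usigma_le`.

This implies the stated bound: the square bracket there equals `1/(1-av)`, and the other denominator
lies in `(0, 1]`.

Only orthonormality of the plane waves is needed, not completeness, because every norm is read off
from Fourier coefficients. -/

noncomputable section

namespace PlaneWave

/-! ### Abstract perturbation of a fixed-point equation and its Neumann series. -/

section Perturbation

variable {E : Type*} [NormedAddCommGroup E] [NormedSpace ℂ E]

/-- A solution `x` of `(1 + T) x = y` with `‖T‖ ≤ t < 1` is bounded by `‖y‖ / (1 - t)`. -/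
theorem norm_le_div_of_add_apply_eq {T : E →L[ℂ] E} {t : ℝ} (hT : ‖T‖ ≤ t) (ht : t < 1)
    {x y : E} (h : x + T x = y) : ‖x‖ ≤ ‖y‖ / (1 - t) := by
  rw [le_div_iff₀ (by linarith)]
  have h1 : ‖x‖ ≤ ‖y‖ + ‖T x‖ := by
    rw [← h]
    simpa using norm_sub_le (x + T x) (T x)
  have h2 : ‖T x‖ ≤ t * ‖x‖ := T.le_of_opNorm_le hT x
  linarith

theorem exists_add_apply_eq [CompleteSpace E] {T : E →L[ℂ] E} (hT : ‖T‖ < 1) (y : E) :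
    ∃ x, x + T x = y := by
  have hu : IsUnit (1 + T) := by
    have := isUnit_one_sub_of_norm_lt_one (x := -T) (by rwa [norm_neg])
    rwa [sub_neg_eq_add] at this
  obtain ⟨u, hu⟩ := hu
  refine ⟨(u⁻¹ : (E →L[ℂ] E)ˣ).1 y, ?_⟩
  have := congrArg (fun S : E →L[ℂ] E => S y) (u.mul_inv)
  rw [hu] at this
  simpa using this

/-- The solution of `(1 + g A) x = g z`, compared with the partial Neumann series in which `g` is
replaced by `g'`. -/
theorem norm_sub_neumann_le [CompleteSpace E] {A g g' : E →L[ℂ] E} {v a ε : ℝ}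
    (hA : ‖A‖ ≤ v) (hg : ‖g‖ ≤ a) (hg' : ‖g'‖ ≤ a) (hε : ‖g - g'‖ ≤ ε) (hav : a * v < 1)
    (K : ℕ) {x z : E} (hx : x + g (A x) = g z) :
    ‖x - ∑ k ∈ Finset.range (K + 1), (-1 : ℂ) ^ k • g' (((A ∘L g') ^ k) z)‖ ≤
      ε / (1 - a * v) ^ 2 * ‖z‖ + a / (1 - a * v) * (a * v) ^ (K + 1) * ‖z‖ := by
  have ha : 0 ≤ a := (norm_nonneg _).trans hg
  have hv : 0 ≤ v := (norm_nonneg _).trans hA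
  have hε0 : 0 ≤ ε := (norm_nonneg _).trans hε
  have hpos : 0 < 1 - a * v := by linarith
  have hgA : ‖g ∘L A‖ ≤ a * v :=
    (g.opNorm_comp_le A).trans (mul_le_mul hg hA (norm_nonneg _) ha)
  have hgA' : ‖g' ∘L A‖ ≤ a * v :=
    (g'.opNorm_comp_le A).trans (mul_le_mul hg' hA (norm_nonneg _) ha)
  have hAg : ‖A ∘L g‖ ≤ a * v :=
    (A.opNorm_comp_le g).trans ((mul_le_mul hA hg (norm_nonneg _) hv).trans_eq (mul_comm _ _))
  have hAg' : ‖A ∘L g'‖ ≤ a * v :=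
    (A.opNorm_comp_le g').trans ((mul_le_mul hA hg' (norm_nonneg _) hv).trans_eq (mul_comm _ _))
  obtain ⟨x', hx'⟩ := exists_add_apply_eq (hgA'.trans_lt hav) (g' z)
  simp only [ContinuousLinearMap.comp_apply] at hx'
  -- the residual `w = z - A x` solves `(1 + A g) w = z`
  have hxw : x = g (z - A x) := by
    rw [map_sub, ← hx, add_sub_cancel_right]
  have hw : ‖z - A x‖ ≤ ‖z‖ / (1 - a * v) := by
    refine norm_le_div_of_add_apply_eq hAg hav ?_
    rw [ContinuousLinearMap.comp_apply, ← hxw, sub_add_cancel]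
  have hband : ‖x - x'‖ ≤ ε / (1 - a * v) ^ 2 * ‖z‖ := by
    -- Subtracting the two equations gives `(1 + g'A)(x - x') = (g - g')(z - A x)`. Each factor
    -- `1/(1-av)` comes from one inversion: this one, and the one in `hw`.
    have h := norm_le_div_of_add_apply_eq hgA' hav (x := x - x') (y := (g - g') (z - A x)) (by
      simp only [ContinuousLinearMap.comp_apply, sub_apply, map_sub]
      rw [← hx, ← hx']
      abel)
    refine h.trans ?_
    rw [div_le_iff₀ hpos]
    calc ‖(g - g') (z - A x)‖ ≤ ε * (‖z‖ / (1 - a * v)) :=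
          ((g - g').le_of_opNorm_le hε _).trans (mul_le_mul_of_nonneg_left hw hε0)
      _ = _ := by field_simp
  have htrunc : ‖x' - ∑ k ∈ Finset.range (K + 1), (-1 : ℂ) ^ k • g' (((A ∘L g') ^ k) z)‖ ≤
      a / (1 - a * v) * (a * v) ^ (K + 1) * ‖z‖ := by
    -- Telescoping for `1 + A g'`. Applying `g'` turns it into an identity for `1 + g'A`, because
    -- `g'(1 + A g') = (1 + g'A) g'`.
    have hgeom : ∀ n : ℕ, (∑ k ∈ Finset.range n, (-1 : ℂ) ^ k • ((A ∘L g') ^ k) z)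
        + (A ∘L g') (∑ k ∈ Finset.range n, (-1 : ℂ) ^ k • ((A ∘L g') ^ k) z)
        = z - (-1 : ℂ) ^ n • ((A ∘L g') ^ n) z := by
      intro n
      induction n with
      | zero => simp
      | succ n ih =>
        rw [Finset.sum_range_succ, map_add, add_add_add_comm, ih, map_smul, pow_succ' (A ∘L g'),
          mul_apply_eq_comp, pow_succ (-1 : ℂ), mul_neg_one, neg_smul]
        abel
    have h := norm_le_div_of_add_apply_eq hgA' hav
      (x := x' - ∑ k ∈ Finset.range (K + 1), (-1 : ℂ) ^ k • g' (((A ∘L g') ^ k) z))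
      (y := g' ((-1 : ℂ) ^ (K + 1) • ((A ∘L g') ^ (K + 1)) z)) (by
        have h1 := congrArg g' (hgeom (K + 1))
        simp only [map_add, map_sub, map_sum, map_smul, ContinuousLinearMap.comp_apply] at h1 ⊢
        rw [sub_add_sub_comm, hx', h1, sub_sub_cancel])
    refine h.trans ?_
    rw [div_le_iff₀ hpos]
    have hpow : ‖((A ∘L g') ^ (K + 1)) z‖ ≤ (a * v) ^ (K + 1) * ‖z‖ :=
      ContinuousLinearMap.le_of_opNorm_le _
        ((norm_pow_le' _ (Nat.succ_pos K)).trans (pow_le_pow_left₀ (norm_nonneg _) hAg' _)) z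
    calc ‖g' ((-1 : ℂ) ^ (K + 1) • ((A ∘L g') ^ (K + 1)) z)‖
        ≤ a * ‖(-1 : ℂ) ^ (K + 1) • ((A ∘L g') ^ (K + 1)) z‖ := g'.le_of_opNorm_le hg' _
      _ ≤ a * ((a * v) ^ (K + 1) * ‖z‖) := by
          rw [norm_smul, norm_pow, norm_neg, norm_one, one_pow, one_mul]
          exact mul_le_mul_of_nonneg_left hpow ha
      _ = _ := by field_simp
  calc _ = ‖(x - x') +
        (x' - ∑ k ∈ Finset.range (K + 1), (-1 : ℂ) ^ k • g' (((A ∘L g') ^ k) z))‖ := by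
        rw [sub_add_sub_cancel]
    _ ≤ _ := (norm_add_le _ _).trans (add_le_add hband htrunc)

end Perturbation

/-! ### Diagonal operators and matrices on `ℓ²`. -/

section SequenceSpace

variable {ι : Type*}

/-- The space `ℓ²` of complex sequences. -/
abbrev Seq (ι : Type*) : Type _ := lp (fun _ : ι => ℂ) 2

theorem memℓp_two_iff {x : ι → ℂ} : Memℓp x 2 ↔ Summable fun k => ‖x k‖ ^ 2 := by
  rw [memℓp_gen_iff (by norm_num)]
  simp

/-- Multiplication by a bounded sequence on `ℓ²`. -/
def diag (m : ι → ℝ) (C : ℝ) (hm : ∀ k, |m k| ≤ C) : Seq ι →L[ℂ] Seq ι :=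
  have hb (x : Seq ι) (k : ι) : ‖(m k : ℂ) * x k‖ ≤ ‖((C : ℂ) • x) k‖ := by
    rw [lp.coeFn_smul, Pi.smul_apply, smul_eq_mul, norm_mul, norm_mul, Complex.norm_real,
      Complex.norm_real]
    exact mul_le_mul_of_nonneg_right ((hm k).trans (le_abs_self C)) (norm_nonneg _)
  LinearMap.mkContinuous
    { toFun := fun x => ⟨fun k => (m k : ℂ) * x k, memℓp_two_iff.2 <|
        Summable.of_nonneg_of_le (fun _ => by positivity)
          (fun k => pow_le_pow_left₀ (norm_nonneg _) (hb x k) 2)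
          (memℓp_two_iff.1 (lp.memℓp ((C : ℂ) • x)))⟩
      map_add' := fun x y => by ext k; exact mul_add _ _ _
      map_smul' := fun c x => by ext k; exact mul_left_comm _ _ _ } |C| fun x => by
    refine (lp.norm_mono two_ne_zero (y := (C : ℂ) • x) (hb x)).trans ?_
    rw [norm_smul, Complex.norm_real, Real.norm_eq_abs]

@[simp]
theorem diag_apply (m : ι → ℝ) (C : ℝ) (hm : ∀ k, |m k| ≤ C) (x : Seq ι) (k : ι) :
    diag m C hm x k = m k * x k := rfl

theorem norm_diag_le {m : ι → ℝ} {C : ℝ} (hm : ∀ k, |m k| ≤ C) (hC : 0 ≤ C) :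
    ‖diag m C hm‖ ≤ C :=
  ContinuousLinearMap.opNorm_le_bound _ hC fun x => by
    refine (lp.norm_mono two_ne_zero (y := (C : ℂ) • x) fun k => ?_).trans_eq ?_
    · rw [diag_apply, lp.coeFn_smul, Pi.smul_apply, smul_eq_mul, norm_mul, norm_mul,
        Complex.norm_real, Complex.norm_real]
      exact mul_le_mul_of_nonneg_right ((hm k).trans (le_abs_self C)) (norm_nonneg _)
    · rw [norm_smul, Complex.norm_real, Real.norm_of_nonneg hC]

/-- Finitely supported sequences as elements of `ℓ²`. -/
def ofFinsupp : (ι →₀ ℂ) →ₗ[ℂ] Seq ι where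
  toFun c := ⟨fun k => c k, memℓp_two_iff.2 <| summable_of_ne_finset_zero (s := c.support) fun k hk => by
    rw [Finsupp.notMem_support_iff.1 hk]; simp⟩
  map_add' _ _ := rfl
  map_smul' _ _ := rfl

@[simp]
theorem ofFinsupp_apply (c : ι →₀ ℂ) (k : ι) : ofFinsupp c k = c k := rfl

theorem denseRange_ofFinsupp : DenseRange (ofFinsupp : (ι →₀ ℂ) →ₗ[ℂ] Seq ι) := by
  classical
  intro x
  refine mem_closure_of_tendsto (lp.hasSum_single (by norm_num) x)
    (Filter.Eventually.of_forall fun s => ?_)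
  refine ⟨∑ i ∈ s, Finsupp.single i (x i), ?_⟩
  rw [map_sum]
  refine Finset.sum_congr rfl fun i _ => ?_
  ext k
  rw [ofFinsupp_apply, lp.single_apply, Finsupp.single_eq_pi_single]

/-- A matrix which maps finitely supported sequences boundedly to `ℓ²` defines a bounded operator
on `ℓ²`. -/
theorem exists_clm_of_matrix (a : ι → ι → ℂ) (C : ℝ) (hC : 0 ≤ C)
    (hmem : ∀ c : ι →₀ ℂ, Memℓp (fun j => ∑' k, a j k * c k) 2)
    (hbound : ∀ c : ι →₀ ℂ, ‖(⟨_, hmem c⟩ : Seq ι)‖ ≤ C * ‖ofFinsupp c‖) :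
    ∃ A : Seq ι →L[ℂ] Seq ι, ‖A‖ ≤ C ∧ ∀ x j, HasSum (fun k => a j k * x k) (A x j) := by
  classical
  have hs (c : ι →₀ ℂ) (j : ι) : Summable fun k => a j k * c k :=
    summable_of_ne_finset_zero (s := c.support) fun k hk => by
      rw [Finsupp.notMem_support_iff.1 hk, mul_zero]
  let f : (ι →₀ ℂ) →ₗ[ℂ] Seq ι :=
    { toFun := fun c => ⟨_, hmem c⟩
      map_add' := fun c c' => by
        ext j
        simp only [lp.coeFn_add, Pi.add_apply, Finsupp.add_apply, mul_add]
        exact (hs c j).tsum_add (hs c' j)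
      map_smul' := fun t c => by
        ext j
        simp only [lp.coeFn_smul, Pi.smul_apply, Finsupp.smul_apply, smul_eq_mul,
          RingHom.id_apply, mul_left_comm _ t]
        exact tsum_mul_left }
  refine ⟨f.extendOfNorm ofFinsupp,
    LinearMap.opNorm_extendOfNorm_le denseRange_ofFinsupp hC hbound, fun x j => ?_⟩
  -- Expanding `x` in unit vectors and evaluating at `j` shows that the extension is still given by
  -- the matrix series. Actual convergence matters: `PerDist.act` is a `tsum`, which would be `0`
  -- for a divergent series.
  have h := ((lp.hasSum_single (by norm_num) x).mapL (f.extendOfNorm ofFinsupp)).mapL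
    (lp.evalCLM ℂ (fun _ : ι => ℂ) 2 j)
  have h1 (k : ι) : lp.evalCLM ℂ (fun _ : ι => ℂ) 2 j
      (f.extendOfNorm ofFinsupp (lp.single 2 k (x k))) = a j k * x k := by
    have hk : lp.single 2 k (x k) = ofFinsupp (Finsupp.single k (x k)) := by
      ext i
      rw [ofFinsupp_apply, lp.single_apply, Finsupp.single_eq_pi_single]
    rw [hk, LinearMap.extendOfNorm_eq denseRange_ofFinsupp ⟨C, hbound⟩]
    change ∑' i, a j i * Finsupp.single k (x k) i = _
    rw [tsum_eq_single k fun i hi => by rw [Finsupp.single_eq_of_ne hi, mul_zero],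
      Finsupp.single_eq_same]
  simp only [h1] at h
  exact h

end SequenceSpace

/-! ### The extended norm `l2Norm` against the norm of `ℓ²`. -/

section L2Norm

variable {d : ℕ}

theorem l2Norm_eq_enorm (x : Seq (Fin d → ℤ)) : l2Norm (fun k => x k) = ‖x‖ₑ := by
  have h := lp.hasSum_norm (p := 2) (by norm_num) x
  simp only [ENNReal.toReal_ofNat, Real.rpow_ofNat] at h
  have h1 : ∑' k, ‖x k‖ₑ ^ 2 = ‖x‖ₑ ^ 2 := by
    rw [← ofReal_norm x, ← ENNReal.ofReal_pow (norm_nonneg _), ← h.tsum_eq,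
      ENNReal.ofReal_tsum_of_nonneg (fun _ => by positivity) h.summable]
    refine tsum_congr fun k => ?_
    rw [ENNReal.ofReal_pow (norm_nonneg _), ofReal_norm]
  rw [l2Norm, h1, ← ENNReal.rpow_natCast, ← ENNReal.rpow_mul]
  norm_num

theorem memℓp_two_of_l2Norm_lt_top {c : (Fin d → ℤ) → ℂ} (h : l2Norm c < ⊤) : Memℓp c 2 := by
  have h1 : ∑' k, ‖c k‖ₑ ^ 2 ≠ ⊤ := fun h0 => by simp [l2Norm, h0] at h
  rw [memℓp_two_iff]
  refine (ENNReal.summable_toReal h1).congr fun k => ?_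
  rw [ENNReal.toReal_pow, toReal_enorm]

end L2Norm

/-! ### Orthonormality of the plane waves and Fourier synthesis. -/

section PlaneWaves

variable {d : ℕ} {L : ℝ}

theorem integral_exp_int_mul (hL : 0 < L) {n : ℤ} (hn : n ≠ 0) :
    ∫ x in Set.Ico 0 L, Complex.exp (2 * Real.pi * n / L * Complex.I * x) = 0 := by
  have hL' : (L : ℂ) ≠ 0 := by exact_mod_cast hL.ne'
  have hn' : (n : ℂ) ≠ 0 := by exact_mod_cast hn
  have hpi : (Real.pi : ℂ) ≠ 0 := by exact_mod_cast Real.pi_ne_zero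
  have hc : 2 * Real.pi * n / L * Complex.I ≠ 0 := by
    simp [hL', hn', hpi]
  rw [integral_Ico_eq_integral_Ioc, ← intervalIntegral.integral_of_le hL.le,
    integral_exp_mul_complex hc]
  have h : 2 * Real.pi * n / L * Complex.I * L = n * (2 * Real.pi * Complex.I) := by
    field_simp
  rw [h, Complex.exp_int_mul_two_pi_mul_I]
  simp

theorem conj_pwFun_mul_pwFun (hL : 0 < L) (j k : Fin d → ℤ) (x : Fin d → ℝ) :
    starRingEnd ℂ (pwFun L j x) * pwFun L k x =
      ((L ^ d)⁻¹ : ℝ) *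
        ∏ i, Complex.exp (2 * Real.pi * ((k i - j i : ℤ) : ℂ) / L * Complex.I * x i) := by
  have hs : (Real.sqrt (L ^ d))⁻¹ * (Real.sqrt (L ^ d))⁻¹ = (L ^ d)⁻¹ := by
    rw [← mul_inv, Real.mul_self_sqrt (by positivity)]
  unfold pwFun
  rw [map_mul, Complex.conj_ofReal, ← Complex.exp_conj, map_mul, Complex.conj_ofReal,
    Complex.conj_I, mul_mul_mul_comm, ← Complex.ofReal_mul, hs, ← Complex.exp_add,
    ← Complex.exp_sum]
  congr 2
  push_cast
  rw [Finset.sum_mul, Finset.sum_mul, ← Finset.sum_add_distrib]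
  refine Finset.sum_congr rfl fun i _ => ?_
  ring

/-- The integral factors over the coordinates; if `j ≠ k`, some factor is the integral of a
nonconstant exponential over full periods and vanishes. -/
theorem inner_pw (hL : 0 < L) (j k : Fin d → ℤ) :
    inner ℂ (pw L j) (pw L k) = if j = k then 1 else 0 := by
  have h1 : inner ℂ (pw L j) (pw L k) =
      ∫ x, starRingEnd ℂ (pwFun L j x) * pwFun L k x ∂(volume.restrict (cell d L)) := by
    rw [MeasureTheory.L2.inner_def]
    refine integral_congr_ae ?_
    filter_upwards [(memLp_pwFun L j).coeFn_toLp, (memLp_pwFun L k).coeFn_toLp] with x hj hk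
    rw [pw, pw, hj, hk, RCLike.inner_apply, mul_comm]
  rw [h1]
  simp_rw [conj_pwFun_mul_pwFun hL]
  rw [integral_const_mul, cell, volume_pi, Measure.restrict_pi_pi,
    integral_fintype_prod_eq_prod
      (f := fun i (t : ℝ) => Complex.exp (2 * Real.pi * ((k i - j i : ℤ) : ℂ) / L * Complex.I * t))]
  split_ifs with h
  · subst h
    have hL' : (L : ℂ) ≠ 0 := by exact_mod_cast hL.ne'
    simp [hL.le, hL']
  · obtain ⟨i, hi⟩ := Function.ne_iff.1 h
    rw [Finset.prod_eq_zero (Finset.mem_univ i)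
      (integral_exp_int_mul hL (sub_ne_zero.2 (Ne.symm hi))), mul_zero]

theorem orthonormal_pw (hL : 0 < L) : Orthonormal ℂ (pw (d := d) L) :=
  orthonormal_iff_ite.2 (inner_pw hL)

/-- The isometry from `ℓ²` to `L²_per` given by Fourier series. -/
def synth (hL : 0 < L) : Seq (Fin d → ℤ) →ₗᵢ[ℂ] L2per d L :=
  (orthonormal_pw hL).orthogonalFamily.linearIsometry

theorem synth_single (hL : 0 < L) (k : Fin d → ℤ) (a : ℂ) :
    synth hL (lp.single 2 k a) = a • pw L k := by
  rw [synth, OrthogonalFamily.linearIsometry_apply_single,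
    LinearIsometry.toSpanSingleton_apply]

theorem coeff_synth (hL : 0 < L) (x : Seq (Fin d → ℤ)) (k : Fin d → ℤ) :
    coeff (synth hL x) k = x k := by
  have h : pw L k = synth hL (lp.single 2 k 1) := by rw [synth_single, one_smul]
  rw [coeff, h, LinearIsometry.inner_map_map, lp.inner_single_left]
  simp

theorem trig_eq_synth (hL : 0 < L) (c : (Fin d → ℤ) →₀ ℂ) :
    trig L c = synth hL (ofFinsupp c) := by
  have h : ofFinsupp c = c.sum fun k a => lp.single 2 k a := by
    conv_lhs => rw [← c.sum_single, Finsupp.sum, map_sum]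
    refine Finset.sum_congr rfl fun k _ => ?_
    ext i
    rw [ofFinsupp_apply, lp.single_apply, Finsupp.single_eq_pi_single]
  rw [h, Finsupp.sum, map_sum]
  exact Finset.sum_congr rfl fun k _ => (synth_single hL k _).symm

theorem coeff_trig (hL : 0 < L) (c : (Fin d → ℤ) →₀ ℂ) (k : Fin d → ℤ) :
    coeff (trig L c) k = c k := by
  rw [trig_eq_synth hL, coeff_synth, ofFinsupp_apply]

theorem enorm_trig (hL : 0 < L) (c : (Fin d → ℤ) →₀ ℂ) : ‖trig L c‖ₑ = ‖ofFinsupp c‖ₑ := by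
  rw [trig_eq_synth hL, ← ofReal_norm, LinearIsometry.norm_map, ofReal_norm]

theorem coeff_sub (u w : L2per d L) (k : Fin d → ℤ) :
    coeff (u - w) k = coeff u k - coeff w k := inner_sub_right _ _ _

theorem coeff_neg (u : L2per d L) (k : Fin d → ℤ) : coeff (-u) k = -coeff u k :=
  inner_neg_right _ _

theorem coeff_smul (c : ℂ) (u : L2per d L) (k : Fin d → ℤ) : coeff (c • u) k = c * coeff u k :=
  inner_smul_right _ _ _

theorem coeff_sum {α : Type*} (s : Finset α) (u : α → L2per d L) (k : Fin d → ℤ) :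
    coeff (∑ i ∈ s, u i) k = ∑ i ∈ s, coeff (u i) k := inner_sum _ _ _

open Classical in
theorem coeff_proj (hL : 0 < L) (S : Finset (Fin d → ℤ)) (c : (Fin d → ℤ) → ℂ)
    (k : Fin d → ℤ) : coeff (proj L S c) k = if k ∈ S then c k else 0 := by
  rw [proj, coeff_sum]
  simp only [coeff_smul]
  simp only [coeff, inner_pw hL, mul_ite, mul_one, mul_zero, Finset.sum_ite_eq]

end PlaneWaves

/-! ### Bounds on the conjugated free resolvent. -/

section Symbols

variable {d : ℕ} {L : ℝ}

theorem freqSq_nonneg (L : ℝ) (k : Fin d → ℤ) : 0 ≤ freqSq L k :=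
  Finset.sum_nonneg fun _ _ => sq_nonneg _

theorem bessel_pos (L s : ℝ) (k : Fin d → ℤ) : 0 < bessel L s k :=
  Real.rpow_pos_of_pos (by linarith [freqSq_nonneg L k]) _

theorem bessel_ne_zero (L s : ℝ) (k : Fin d → ℤ) : (bessel L s k : ℂ) ≠ 0 :=
  Complex.ofReal_ne_zero.2 (bessel_pos L s k).ne'

theorem bessel_sq (L r : ℝ) (k : Fin d → ℤ) :
    bessel L (-1 / 2 + r / 2) k ^ 2 = (freqSq L k + 1) ^ (r - 1) := by
  rw [bessel, ← Real.rpow_natCast, ← Real.rpow_mul (by linarith [freqSq_nonneg L k])]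
  congr 1
  push_cast
  ring

/-- The symbol of `(-Δ+1)^{1/2-r/2} (-Δ-lam)^{-1} (-Δ+1)^{1/2-r/2}`. -/
def green (L r lam : ℝ) (k : Fin d → ℤ) : ℝ :=
  (bessel L (-1 / 2 + r / 2) k ^ 2 * (freqSq L k - lam))⁻¹

theorem green_nonneg {r lam : ℝ} {k : Fin d → ℤ} (hlam : lam ≤ freqSq L k / 2) :
    0 ≤ green L r lam k :=
  inv_nonneg.2 (mul_nonneg (sq_nonneg _) (by linarith [freqSq_nonneg L k]))

/-- The factor 4 comes from `|k|² - lam ≥ |k|²/2 ≥ (|k|²+1)/4`; the second inequality uses `|k|² ≥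
1`. -/
theorem green_le {r lam : ℝ} {k : Fin d → ℤ} (hk : 1 ≤ freqSq L k)
    (hlam : lam ≤ freqSq L k / 2) : green L r lam k ≤ 4 * (freqSq L k + 1) ^ (-r) := by
  have hpos : 0 < freqSq L k + 1 := by linarith
  rw [green, bessel_sq]
  refine inv_le_of_inv_le₀ (by positivity) ?_
  rw [mul_inv, ← Real.rpow_neg hpos.le, neg_neg]
  have h : (freqSq L k + 1) ^ r = (freqSq L k + 1) ^ (r - 1) * (freqSq L k + 1) := by
    rw [Real.rpow_sub_one hpos.ne', div_mul_cancel₀ _ hpos.ne']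
  rw [h, mul_left_comm]
  exact mul_le_mul_of_nonneg_left (by linarith) (by positivity)

/-- Taking `R = ρ_M` bounds the full high-frequency resolvent, and `R = ρ_N` the part discarded by
the band. -/
theorem green_le_of_le {r lam R : ℝ} (hr : 0 ≤ r) {k : Fin d → ℤ} (hk : 1 ≤ freqSq L k)
    (hlam : lam ≤ freqSq L k / 2) (hR : 0 < R) (hRk : R ≤ freqSq L k) :
    green L r lam k ≤ 4 * R ^ (-r) :=
  (green_le hk hlam).trans <| mul_le_mul_of_nonneg_left
    (Real.rpow_le_rpow_of_nonpos hR (by linarith) (by linarith)) (by norm_num)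

end Symbols

/-! ### Conjugation by the Bessel weight. -/

section Conjugation

variable {d : ℕ} {L r : ℝ}

theorem coeff_trig_besselTrig (hL : 0 < L) (s : ℝ) (c : (Fin d → ℤ) →₀ ℂ) (k : Fin d → ℤ) :
    coeff (trig L (besselTrig L s c)) k = bessel L s k * c k := by
  rw [coeff_trig hL]
  rfl

/-- If `‖V‖_r < ∞`, then `(-Δ+1)^{-1/2+r/2} V (-Δ+1)^{-1/2+r/2}` is a bounded operator on `ℓ²`. -/
theorem PerDist.exists_conj (V : PerDist d L) (hL : 0 < L)
    (hV : rNorm L r (V.act hL.ne') < ⊤) :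
    ∃ A : Seq (Fin d → ℤ) →L[ℂ] Seq (Fin d → ℤ), ‖A‖ ≤ (rNorm L r (V.act hL.ne')).toReal ∧
      ∀ (u : L2per d L) (x : Seq (Fin d → ℤ)),
        (∀ k, coeff u k = bessel L (-1 / 2 + r / 2) k * x k) →
        ∀ j, (bessel L (-1 / 2 + r / 2) j : ℂ) * V.act hL.ne' u j = A x j := by
  set b : (Fin d → ℤ) → ℂ := fun k => bessel L (-1 / 2 + r / 2) k
  set C := (rNorm L r (V.act hL.ne')).toReal
  let a : (Fin d → ℤ) → (Fin d → ℤ) → ℂ := fun j k => b j * (V.elem hL.ne' j k * b k)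
  have ha (u : L2per d L) (x : (Fin d → ℤ) → ℂ) (hx : ∀ k, coeff u k = b k * x k)
      (j : Fin d → ℤ) : b j * V.act hL.ne' u j = ∑' k, a j k * x k := by
    rw [PerDist.act, ← tsum_mul_left]
    refine tsum_congr fun k => ?_
    rw [hx, mul_assoc, mul_assoc]
  have hle (c : (Fin d → ℤ) →₀ ℂ) :
      l2Norm (fun j => ∑' k, a j k * c k) ≤ ENNReal.ofReal C * ‖ofFinsupp c‖ₑ := by
    -- The quotient in `rNorm` can be cleared only for a nonzero denominator.
    rcases eq_or_ne c 0 with rfl | hc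
    · simp [l2Norm]
    have h : l2Norm (fun j => b j * V.act hL.ne' (trig L (besselTrig L (-1 / 2 + r / 2) c)) j) /
        ‖trig L c‖ₑ ≤ rNorm L r (V.act hL.ne') :=
      le_iSup (fun c : (Fin d → ℤ) →₀ ℂ =>
        l2Norm (fun j => b j * V.act hL.ne' (trig L (besselTrig L (-1 / 2 + r / 2) c)) j) /
          ‖trig L c‖ₑ) c
    have hc' : ofFinsupp c ≠ 0 := fun h0 => hc <| by
      ext k
      rw [← ofFinsupp_apply c k, h0]
      rfl
    rw [enorm_trig hL, ENNReal.div_le_iff (enorm_ne_zero.2 hc') enorm_ne_top] at h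
    simp only [ha _ _ (coeff_trig_besselTrig hL (-1 / 2 + r / 2) c)] at h
    rwa [ENNReal.ofReal_toReal hV.ne]
  have hmem (c : (Fin d → ℤ) →₀ ℂ) : Memℓp (fun j => ∑' k, a j k * c k) 2 :=
    memℓp_two_of_l2Norm_lt_top
      ((hle c).trans_lt (ENNReal.mul_lt_top ENNReal.ofReal_lt_top enorm_lt_top))
  obtain ⟨A, hA, hsum⟩ := exists_clm_of_matrix a C ENNReal.toReal_nonneg hmem fun c => by
    have h := (l2Norm_eq_enorm (⟨_, hmem c⟩ : Seq (Fin d → ℤ))).symm.trans_le (hle c)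
    rw [← ofReal_norm, ← ofReal_norm, ← ENNReal.ofReal_mul ENNReal.toReal_nonneg] at h
    exact (ENNReal.ofReal_le_ofReal_iff
      (mul_nonneg ENNReal.toReal_nonneg (norm_nonneg _))).1 h
  exact ⟨A, hA, fun u x hx j => (ha u x hx j).trans (hsum x j).tsum_eq⟩

theorem rNorm_le (hL : 0 < L) {B : L2per d L → (Fin d → ℤ) → ℂ} {C : ℝ} (hC : 0 ≤ C)
    (h : ∀ c : (Fin d → ℤ) →₀ ℂ, ∃ y : Seq (Fin d → ℤ), ‖y‖ ≤ C * ‖ofFinsupp c‖ ∧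
      ∀ j, (bessel L (-1 / 2 + r / 2) j : ℂ) *
        B (trig L (besselTrig L (-1 / 2 + r / 2) c)) j = y j) :
    rNorm L r B ≤ ENNReal.ofReal C := by
  refine iSup_le fun c => ?_
  obtain ⟨y, hy, hyB⟩ := h c
  refine ENNReal.div_le_of_le_mul ?_
  simp only [hyB]
  rw [l2Norm_eq_enorm, enorm_trig hL, ← ofReal_norm, ← ofReal_norm, ← ENNReal.ofReal_mul hC]
  exact ENNReal.ofReal_le_ofReal hy

open Classical in
/-- Restriction of a sequence to a set of frequencies. -/
def cutoff (S : Finset (Fin d → ℤ)) : Seq (Fin d → ℤ) →L[ℂ] Seq (Fin d → ℤ) :=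
  diag (fun k => if k ∈ S then 1 else 0) 1 fun k => by split_ifs <;> simp

open Classical in
theorem cutoff_apply (S : Finset (Fin d → ℤ)) (x : Seq (Fin d → ℤ)) (k : Fin d → ℤ) :
    cutoff S x k = if k ∈ S then x k else 0 := by
  rw [cutoff, diag_apply]
  split_ifs <;> simp

theorem norm_cutoff_le (S : Finset (Fin d → ℤ)) : ‖cutoff S‖ ≤ 1 :=
  norm_diag_le _ zero_le_one

end Conjugation

/-! ### The exact resolvent and the truncated series in conjugated form. -/

section Interactions

variable {d : ℕ} {L r lam : ℝ} {M N : ℕ} {V : PerDist d L}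
  {A : Seq (Fin d → ℤ) →L[ℂ] Seq (Fin d → ℤ)}

/-- The candidate is `u = b x`. The point is that it lies in `H¹`, although `x` is only known to be
in `ℓ²`: the equation expresses `x` through `g`, which gains the missing decay. -/
theorem exists_isPerpSolution (hL : 0 < L) (hr : 0 ≤ r) (hM : 1 ≤ rho L M)
    (hlam : lam ≤ rho L M / 2)
    (hA : ∀ (u : L2per d L) (x : Seq (Fin d → ℤ)),
      (∀ k, coeff u k = bessel L (-1 / 2 + r / 2) k * x k) →
      ∀ j, (bessel L (-1 / 2 + r / 2) j : ℂ) * V.act hL.ne' u j = A x j)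
    {g : Seq (Fin d → ℤ) →L[ℂ] Seq (Fin d → ℤ)}
    (hg : ∀ x k, g x k = ((if rho L M ≤ freqSq L k then green L r lam k else 0 : ℝ) : ℂ) * x k)
    {f : (Fin d → ℤ) → ℂ} {x z : Seq (Fin d → ℤ)}
    (hz : ∀ j, (bessel L (-1 / 2 + r / 2) j : ℂ) * f j = z j) (hx : x + g (A x) = g z) :
    ∃ u, IsPerpSolution hL.ne' V M lam f u := by
  set b : (Fin d → ℤ) → ℝ := bessel L (-1 / 2 + r / 2)
  have hxw (k : Fin d → ℤ) :
      x k = ((if rho L M ≤ freqSq L k then green L r lam k else 0 : ℝ) : ℂ) * (z - A x) k := by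
    rw [← hg, map_sub, ← hx, add_sub_cancel_right]
  -- The weight `(|k|²+1) b²` is `(|k|²+1)^r` and `green²` is at most `16 (|k|²+1)^(-2r)`, so the
  -- product is at most `16 (|k|²+1)^(-r) ≤ 16`.
  have hreg (k : Fin d → ℤ) :
      (freqSq L k + 1) * ‖(b k : ℂ) * x k‖ ^ 2 ≤ 16 * ‖(z - A x) k‖ ^ 2 := by
    rw [hxw k]
    split_ifs with hk
    · have hk1 : 1 ≤ freqSq L k := hM.trans hk
      have hl : lam ≤ freqSq L k / 2 := by linarith
      have hpos : 0 < freqSq L k + 1 := by linarith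
      have h0 := green_nonneg (r := r) hl
      have h1 := green_le (r := r) hk1 hl
      rw [norm_mul, norm_mul, Complex.norm_real, Complex.norm_real, ← mul_assoc, mul_pow, mul_pow,
        Real.norm_eq_abs, Real.norm_eq_abs, sq_abs, sq_abs, bessel_sq, ← mul_assoc]
      refine mul_le_mul_of_nonneg_right ?_ (sq_nonneg _)
      rw [← mul_assoc]
      calc (freqSq L k + 1) * (freqSq L k + 1) ^ (r - 1) * green L r lam k ^ 2
          ≤ (freqSq L k + 1) * (freqSq L k + 1) ^ (r - 1) * (4 * (freqSq L k + 1) ^ (-r)) ^ 2 := by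
            gcongr
        _ = 16 * (freqSq L k + 1) ^ (-r) := by
            have h2 : (freqSq L k + 1) * (freqSq L k + 1) ^ (r - 1) = (freqSq L k + 1) ^ r := by
              rw [Real.rpow_sub_one hpos.ne', mul_div_cancel₀ _ hpos.ne']
            have h3 : (freqSq L k + 1) ^ r * (freqSq L k + 1) ^ (-r) = 1 := by
              rw [← Real.rpow_add hpos, add_neg_cancel, Real.rpow_zero]
            rw [h2]
            linear_combination 16 * (freqSq L k + 1) ^ (-r) * h3
        _ ≤ 16 * 1 := by
            gcongr
            exact Real.rpow_le_one_of_one_le_of_nonpos (by linarith) (by linarith)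
        _ = 16 := by norm_num
    · simp only [Complex.ofReal_zero, zero_mul, mul_zero, norm_zero]
      rw [zero_pow two_ne_zero, mul_zero]
      positivity
  have hsum : Summable fun k => (freqSq L k + 1) * ‖(b k : ℂ) * x k‖ ^ 2 :=
    Summable.of_nonneg_of_le (fun k => by have := freqSq_nonneg L k; positivity) hreg
      ((memℓp_two_iff.1 (lp.memℓp (z - A x))).mul_left 16)
  have hmem : Memℓp (fun k => (b k : ℂ) * x k) 2 := memℓp_two_iff.2 <|
    Summable.of_nonneg_of_le (fun _ => by positivity)
      (fun k => le_mul_of_one_le_left (by positivity) (by linarith [freqSq_nonneg L k])) hsum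
  have hu (k : Fin d → ℤ) : coeff (synth hL ⟨_, hmem⟩) k = b k * x k := coeff_synth hL _ k
  refine ⟨synth hL ⟨_, hmem⟩, ?_, fun k hk => ?_, fun j hj => ?_⟩
  · simpa only [hu] using hsum
  · rw [hu, hxw, if_neg hk.not_ge, Complex.ofReal_zero, zero_mul, mul_zero]
  · have hb : (b j : ℂ) ≠ 0 := bessel_ne_zero _ _ _
    have hfl : ((freqSq L j - lam : ℝ) : ℂ) ≠ 0 :=
      Complex.ofReal_ne_zero.2 (by linarith)
    refine mul_left_cancel₀ hb ?_
    have hgr : green L r lam j = (b j ^ 2 * (freqSq L j - lam))⁻¹ := rfl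
    have h1 := hxw j
    rw [if_pos hj, hgr, lp.coeFn_sub, Pi.sub_apply] at h1
    rw [mul_add, hA _ x hu, hz, hu, h1]
    push_cast at hfl ⊢
    field_simp
    ring

/-- The resolvent of the Schur block `H_M^⊥` in conjugated form. -/
theorem exists_perpResolvent_eq (hL : 0 < L) (hr : 0 ≤ r) (hM : 1 ≤ rho L M)
    (hlam : lam ≤ rho L M / 2)
    (hA : ∀ (u : L2per d L) (x : Seq (Fin d → ℤ)),
      (∀ k, coeff u k = bessel L (-1 / 2 + r / 2) k * x k) →
      ∀ j, (bessel L (-1 / 2 + r / 2) j : ℂ) * V.act hL.ne' u j = A x j)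
    {g : Seq (Fin d → ℤ) →L[ℂ] Seq (Fin d → ℤ)}
    (hg : ∀ x k, g x k = ((if rho L M ≤ freqSq L k then green L r lam k else 0 : ℝ) : ℂ) * x k)
    (hgA : ‖g ∘L A‖ < 1) {f : (Fin d → ℤ) → ℂ} {z : Seq (Fin d → ℤ)}
    (hz : ∀ j, (bessel L (-1 / 2 + r / 2) j : ℂ) * f j = z j) :
    ∃ x : Seq (Fin d → ℤ), x + g (A x) = g z ∧
      ∀ k, coeff (perpResolvent hL.ne' V M lam f) k = bessel L (-1 / 2 + r / 2) k * x k := by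
  obtain ⟨x₀, hx₀⟩ := exists_add_apply_eq hgA (g z)
  -- `x₀` serves only to exclude the default value `0` of `perpResolvent`. The sequence `x` below
  -- comes from the chosen solution, so no uniqueness argument is needed.
  have hex := exists_isPerpSolution hL hr hM hlam hA hg hz hx₀
  rw [perpResolvent, dif_pos hex]
  obtain ⟨hsum, hzero, heq⟩ := hex.choose_spec
  set u := hex.choose
  set b : (Fin d → ℤ) → ℝ := bessel L (-1 / 2 + r / 2)
  have hb (k : Fin d → ℤ) : (b k : ℂ) ≠ 0 := bessel_ne_zero _ _ _
  -- This is `H¹ ⊆ H^(1-r)`, valid as `r ≥ 0`.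
  have hmem : Memℓp (fun k => (b k : ℂ)⁻¹ * coeff u k) 2 := by
    refine memℓp_two_iff.2 (Summable.of_nonneg_of_le (fun _ => by positivity) (fun k => ?_) hsum)
    have hf := freqSq_nonneg L k
    rw [norm_mul, mul_pow, norm_inv, Complex.norm_real, inv_pow, Real.norm_eq_abs, sq_abs,
      bessel_sq, ← Real.rpow_neg (by linarith)]
    refine mul_le_mul_of_nonneg_right ?_ (sq_nonneg _)
    calc (freqSq L k + 1) ^ (-(r - 1)) ≤ (freqSq L k + 1) ^ (1 : ℝ) :=
          Real.rpow_le_rpow_of_exponent_le (by linarith) (by linarith)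
      _ = _ := Real.rpow_one _
  let x : Seq (Fin d → ℤ) := ⟨_, hmem⟩
  have hux (k : Fin d → ℤ) : coeff u k = b k * x k := (mul_inv_cancel_left₀ (hb k) _).symm
  refine ⟨x, ?_, hux⟩
  ext j
  rw [lp.coeFn_add, Pi.add_apply, hg, hg]
  split_ifs with hj
  · have hfl : ((freqSq L j - lam : ℝ) : ℂ) ≠ 0 := Complex.ofReal_ne_zero.2 (by linarith)
    have hgr : green L r lam j = (b j ^ 2 * (freqSq L j - lam))⁻¹ := rfl
    rw [← hA u x hux, ← hz, ← heq j hj, hux, hgr]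
    have := hb j
    push_cast at hfl ⊢
    field_simp
  · have : x j = 0 := by
      change (b j : ℂ)⁻¹ * coeff u j = 0
      rw [hzero j (not_le.1 hj), mul_zero]
    rw [this]
    simp

open Classical in
/-- The truncated Neumann series in conjugated form. -/
theorem coeff_Rsigma (hL : 0 < L)
    (hA : ∀ (u : L2per d L) (x : Seq (Fin d → ℤ)),
      (∀ k, coeff u k = bessel L (-1 / 2 + r / 2) k * x k) →
      ∀ j, (bessel L (-1 / 2 + r / 2) j : ℂ) * V.act hL.ne' u j = A x j)
    {g : Seq (Fin d → ℤ) →L[ℂ] Seq (Fin d → ℤ)}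
    (hg : ∀ x k, g x k = ((if k ∈ band d L M N then green L r lam k else 0 : ℝ) : ℂ) * x k)
    (K : ℕ) {u : L2per d L} {z : Seq (Fin d → ℤ)}
    (hz : ∀ j ∈ band d L M N, (bessel L (-1 / 2 + r / 2) j : ℂ) * coeff u j = z j)
    (k : Fin d → ℤ) :
    coeff (Rsigma hL.ne' V N M K lam u) k = bessel L (-1 / 2 + r / 2) k *
      (∑ n ∈ Finset.range (K + 1), (-1 : ℂ) ^ n • g (((A ∘L g) ^ n) z) : Seq (Fin d → ℤ)) k := by
  set b : (Fin d → ℤ) → ℝ := bessel L (-1 / 2 + r / 2)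
  have hb (k : Fin d → ℤ) : (b k : ℂ) ≠ 0 := bessel_ne_zero _ _ _
  have hG (w : L2per d L) (y : Seq (Fin d → ℤ))
      (hy : ∀ j ∈ band d L M N, (b j : ℂ) * coeff w j = y j) (k : Fin d → ℤ) :
      coeff (G M N lam w) k = b k * g y k := by
    rw [G, coeff_proj hL, hg]
    split_ifs with hk
    · have := hb k
      have hgr : green L r lam k = (b k ^ 2 * (freqSq L k - lam))⁻¹ := rfl
      rw [← hy k hk, hgr]
      push_cast
      rw [mul_inv]
      field_simp
    · simp
  -- Conjugation turns `[G V]^n G` into `g (A g)^n`. The inner projection in `VMN` has no effect,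
  -- since the range of `g` is supported in the band.
  have hiter (n : ℕ) (k : Fin d → ℤ) :
      coeff ((fun w => G M N lam (VMN hL.ne' V M N w))^[n] (G M N lam u)) k =
        b k * g (((A ∘L g) ^ n) z) k := by
    induction n generalizing k with
    | zero => exact hG u z hz k
    | succ n ih =>
      rw [Function.iterate_succ_apply', pow_succ', mul_apply_eq_comp]
      refine hG _ _ (fun j hj => ?_) k
      rw [VMN, coeff_proj hL, if_pos hj, ContinuousLinearMap.comp_apply]
      refine hA _ _ (fun i => ?_) j
      rw [coeff_proj hL, ih i]
      split_ifs with hi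
      · rfl
      · rw [hg, if_neg hi]
        simp
  rw [Rsigma, coeff_sum, lp.coeFn_sum, Finset.sum_apply, Finset.mul_sum]
  refine Finset.sum_congr rfl fun n _ => ?_
  rw [coeff_smul, hiter, lp.coeFn_smul, Pi.smul_apply, smul_eq_mul]
  ring

end Interactions

/-! ### The truncation error in the `r`-norm. -/

section Comparison

variable {d : ℕ} {L r lam v : ℝ} {M N : ℕ} {V : PerDist d L}

/-- The truncation error, with the Neumann series estimated directly. -/
theorem rNorm_UM_sub_Usigma_le (hL : 0 < L) (hr : 0 ≤ r)
    (hVr : rNorm L r (V.act hL.ne') < ⊤) (hv : v = (rNorm L r (V.act hL.ne')).toReal)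
    (K : ℕ) (hM : 1 ≤ rho L M) (hMN : rho L M ≤ rho L N) (hlam : lam ≤ rho L M / 2)
    (h1 : 4 * rho L M ^ (-r) * v < 1) :
    rNorm L r (fun φ => coeff (UM hL.ne' V M lam φ - Usigma hL.ne' V N M K lam φ)) ≤
      ENNReal.ofReal (v * (4 * rho L N ^ (-r) / (1 - 4 * rho L M ^ (-r) * v) ^ 2 +
        4 * rho L M ^ (-r) / (1 - 4 * rho L M ^ (-r) * v) *
          (4 * rho L M ^ (-r) * v) ^ (K + 1)) * v) := by
  classical
  obtain ⟨A, hAv, hA⟩ := V.exists_conj hL hVr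
  rw [← hv] at hAv
  set b : (Fin d → ℤ) → ℝ := bessel L (-1 / 2 + r / 2)
  set a := 4 * rho L M ^ (-r)
  set ε := 4 * rho L N ^ (-r)
  have hN : 1 ≤ rho L N := hM.trans hMN
  have hv0 : 0 ≤ v := hv ▸ ENNReal.toReal_nonneg
  have ha0 : 0 ≤ a := mul_nonneg (by norm_num) (Real.rpow_nonneg (by linarith) _)
  have hε0 : 0 ≤ ε := mul_nonneg (by norm_num) (Real.rpow_nonneg (by linarith) _)
  have hgreen0 (k : Fin d → ℤ) (hk : rho L M ≤ freqSq L k) : 0 ≤ green L r lam k :=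
    green_nonneg (by linarith)
  have hgreen (k : Fin d → ℤ) (hk : rho L M ≤ freqSq L k) : green L r lam k ≤ a :=
    green_le_of_le hr (hM.trans hk) (by linarith) (by linarith) hk
  have hband (k : Fin d → ℤ) :
      k ∈ band d L M N ↔ rho L M ≤ freqSq L k ∧ freqSq L k < rho L N := by
    rw [band, Finset.mem_sdiff, mem_modes, mem_modes, not_lt, and_comm]
  let g : Seq (Fin d → ℤ) →L[ℂ] Seq (Fin d → ℤ) :=
    diag (fun k => if rho L M ≤ freqSq L k then green L r lam k else 0) a fun k => by
      split_ifs with hk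
      · rw [abs_of_nonneg (hgreen0 k hk)]
        exact hgreen k hk
      · simpa using ha0
  let gN : Seq (Fin d → ℤ) →L[ℂ] Seq (Fin d → ℤ) :=
    diag (fun k => if k ∈ band d L M N then green L r lam k else 0) a fun k => by
      split_ifs with hk
      · rw [abs_of_nonneg (hgreen0 k ((hband k).1 hk).1)]
        exact hgreen k ((hband k).1 hk).1
      · simpa using ha0
  have hga : ‖g‖ ≤ a := norm_diag_le _ ha0
  have hgaN : ‖gN‖ ≤ a := norm_diag_le _ ha0
  have hggN : ‖g - gN‖ ≤ ε := by
    have hm (k : Fin d → ℤ) :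
        |(if rho L N ≤ freqSq L k then green L r lam k else 0)| ≤ ε := by
      split_ifs with hk
      · rw [abs_of_nonneg (hgreen0 k (hMN.trans hk))]
        exact green_le_of_le hr (hN.trans hk) (by linarith) (by linarith) hk
      · simpa using hε0
    -- Removing the band from `|k|² ≥ ρ_M` leaves exactly `|k|² ≥ ρ_N`, because `ρ_M ≤ ρ_N`.
    have h : g - gN = diag _ ε hm := by
      ext x k
      simp only [sub_apply, lp.coeFn_sub, Pi.sub_apply, g, gN, diag_apply, hband]
      by_cases hMk : rho L M ≤ freqSq L k <;> by_cases hNk : rho L N ≤ freqSq L k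
      · simp [hMk, hNk]
      · simp [hMk, hNk, not_le.1 hNk]
      · exact absurd (hMN.trans hNk) hMk
      · simp [hMk, hNk]
    rw [h]
    exact norm_diag_le hm hε0
  have hgA : ‖g ∘L A‖ < 1 :=
    ((g.opNorm_comp_le A).trans (mul_le_mul hga hAv (norm_nonneg _) ha0)).trans_lt h1
  have hC : 0 ≤ ε / (1 - a * v) ^ 2 + a / (1 - a * v) * (a * v) ^ (K + 1) := by
    have : 0 < 1 - a * v := by linarith
    positivity
  refine rNorm_le hL (mul_nonneg (mul_nonneg hv0 hC) hv0) fun c => ?_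
  let P : Seq (Fin d → ℤ) →L[ℂ] Seq (Fin d → ℤ) := cutoff (modes d L M)
  have hP (x : Seq (Fin d → ℤ)) : ‖P x‖ ≤ ‖x‖ := by
    simpa using P.le_of_opNorm_le (norm_cutoff_le _) x
  set φ := trig L (besselTrig L (-1 / 2 + r / 2) c)
  set f := V.act hL.ne' (proj L (modes d L M) (coeff φ))
  let z := A (P (ofFinsupp c))
  have hz (j : Fin d → ℤ) : (b j : ℂ) * f j = z j := by
    refine hA _ _ (fun k => ?_) j
    rw [coeff_proj hL, cutoff_apply]
    split_ifs
    · exact coeff_trig_besselTrig hL _ c k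
    · rw [mul_zero]
  obtain ⟨x, hx, hux⟩ := exists_perpResolvent_eq (V := V) hL hr hM hlam hA
    (g := g) (fun x k => rfl) hgA hz
  set s : Seq (Fin d → ℤ) :=
    ∑ k ∈ Finset.range (K + 1), (-1 : ℂ) ^ k • gN (((A ∘L gN) ^ k) z)
  have hs (k : Fin d → ℤ) : coeff (Rsigma hL.ne' V N M K lam (proj L (band d L M N) f)) k =
      b k * s k := by
    refine coeff_Rsigma hL hA (g := gN) (fun x k => rfl) K (fun j hj => ?_) k
    rw [coeff_proj hL, if_pos hj, hz]
  have hs0 (k : Fin d → ℤ) (hk : k ∉ band d L M N) : s k = 0 := by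
    simp only [s, lp.coeFn_sum, Finset.sum_apply, lp.coeFn_smul, Pi.smul_apply, gN, diag_apply,
      if_neg hk, Complex.ofReal_zero, zero_mul, smul_zero, Finset.sum_const_zero]
  have hs' (k : Fin d → ℤ) : coeff (proj L (band d L M N)
      (coeff (Rsigma hL.ne' V N M K lam (proj L (band d L M N) f)))) k = b k * s k := by
    rw [coeff_proj hL, hs]
    split_ifs with hk
    · rfl
    · rw [hs0 k hk, mul_zero]
  -- Both interactions have the form `-P_M V (b ·)`, applied to `x` and to `s`, so their conjugated
  -- difference is `-P A (x - s)`.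
  refine ⟨-P (A (x - s)), ?_, fun j => ?_⟩
  · have hz' : ‖z‖ ≤ v * ‖ofFinsupp c‖ :=
      (A.le_of_opNorm_le hAv _).trans (mul_le_mul_of_nonneg_left (hP _) hv0)
    have hxs := norm_sub_neumann_le hAv hga hgaN hggN h1 K hx
    rw [← add_mul] at hxs
    calc ‖-P (A (x - s))‖ ≤ v * ‖x - s‖ := by
          rw [norm_neg]
          exact (hP _).trans (A.le_of_opNorm_le hAv _)
      _ ≤ v * ((ε / (1 - a * v) ^ 2 + a / (1 - a * v) * (a * v) ^ (K + 1)) *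
            (v * ‖ofFinsupp c‖)) := by
          gcongr
          exact hxs.trans (mul_le_mul_of_nonneg_left hz' hC)
      _ = _ := by ring
  · change (b j : ℂ) * coeff (UM hL.ne' V M lam φ - Usigma hL.ne' V N M K lam φ) j = _
    rw [coeff_sub, UM, Usigma, coeff_neg, coeff_neg, coeff_proj hL, coeff_proj hL, map_sub,
      lp.coeFn_neg, Pi.neg_apply, cutoff_apply]
    split_ifs with hj
    · rw [lp.coeFn_sub, Pi.sub_apply, ← hA _ x hux j, ← hA _ s hs' j]
      ring
    · simp

end Comparison

end PlaneWave

end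

/-! ### The stated bound from the direct estimate. -/

theorem lemma4p4 (d : ℕ) (hd : 1 ≤ d ∧ d ≤ 3) (L : ℝ) (hL : 0 < L) (r : ℝ) (hr : 0 < r)
    (V : PlaneWave.PerDist d L) (hVreal : V.IsReal)
    (hVr : PlaneWave.rNorm L r (V.act hL.ne') < ⊤)
    (v : ℝ) (hv : v = (PlaneWave.rNorm L r (V.act hL.ne')).toReal)
    (M N K : ℕ) (ρM ρN : ℝ) (hρM : ρM = PlaneWave.rho L M) (hρN : ρN = PlaneWave.rho L N)
    (lam : ℝ) (hlam : lam < min (PlaneWave.kappa L r v M) (ρM / 2))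
    (hM : 1 < ρM) (hMN : ρM ≤ ρN)
    (h1 : 4 * ρM ^ (-r) * v < 1)
    (h2 : 4 * ρN ^ (-r) * v + 16 * ρM ^ (-2 * r) * v ^ 2 / (1 - 4 * ρM ^ (-r) * v) < 1) :
    PlaneWave.rNorm L r (fun φ => PlaneWave.coeff
        (PlaneWave.UM hL.ne' V M lam φ - PlaneWave.Usigma hL.ne' V N M K lam φ)) ≤
      ENNReal.ofReal
        (4 * ρN ^ (-r) * v ^ 2 /
            (1 - 4 * ρN ^ (-r) * v - 16 * ρM ^ (-2 * r) * v ^ 2 / (1 - 4 * ρM ^ (-r) * v)) *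
            (1 + 4 * ρM ^ (-r) * v / (1 - 4 * ρM ^ (-r) * v)) ^ 2 +
          4 * ρM ^ (-r) * v ^ 2 / (1 - 4 * ρM ^ (-r) * v) * (4 * ρM ^ (-r) * v) ^ (K + 1)) := by
  subst hρM hρN
  have hρ0 : 0 < PlaneWave.rho L M := by linarith
  have hv0 : 0 ≤ v := hv ▸ ENNReal.toReal_nonneg
  have hlam' : lam ≤ PlaneWave.rho L M / 2 := (hlam.trans_le (min_le_right _ _)).le
  refine (PlaneWave.rNorm_UM_sub_Usigma_le hL hr.le hVr hv K hM.le hMN hlam' h1).trans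
    (ENNReal.ofReal_le_ofReal ?_)
  have hsq : 16 * PlaneWave.rho L M ^ (-2 * r) = (4 * PlaneWave.rho L M ^ (-r)) ^ 2 := by
    have h : PlaneWave.rho L M ^ (-2 * r) = (PlaneWave.rho L M ^ (-r)) ^ 2 := by
      rw [← Real.rpow_natCast, ← Real.rpow_mul hρ0.le]
      congr 1
      push_cast
      ring
    rw [h]
    ring
  rw [hsq] at h2 ⊢
  have ha0 : 0 ≤ 4 * PlaneWave.rho L M ^ (-r) := by positivity
  have hε0 : 0 ≤ 4 * PlaneWave.rho L N ^ (-r) :=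
    mul_nonneg (by norm_num) (Real.rpow_nonneg (by linarith) _)
  generalize 4 * PlaneWave.rho L M ^ (-r) = a at *
  generalize 4 * PlaneWave.rho L N ^ (-r) = ε at *
  have hpos : 0 < 1 - a * v := by linarith
  have hinv : 1 + a * v / (1 - a * v) = 1 / (1 - a * v) := by
    field_simp
    ring
  have hq : 0 ≤ a ^ 2 * v ^ 2 / (1 - a * v) := by positivity
  have hεv : 0 ≤ ε * v := mul_nonneg hε0 hv0
  -- The denominator is positive by `h2` and at most 1 because both subtracted terms are
  -- nonnegative.
  have hle : ε * v ^ 2 ≤ ε * v ^ 2 / (1 - ε * v - a ^ 2 * v ^ 2 / (1 - a * v)) :=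
    le_div_self (by positivity) (by linarith) (by linarith)
  rw [hinv]
  calc v * (ε / (1 - a * v) ^ 2 + a / (1 - a * v) * (a * v) ^ (K + 1)) * v
      = ε * v ^ 2 * (1 / (1 - a * v)) ^ 2 +
          a * v ^ 2 / (1 - a * v) * (a * v) ^ (K + 1) := by
        field_simp
    _ ≤ _ := by gcongr
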